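/- Let $N\ge 1$ and let $\mathfrak{su}(N)$ be the real Lie algebra of traceless skew-Hermitian complex $N\times N$ matrices. Let $B=(b_{ij})\in\mathfrak{su}(N)$, and let $A=-i\tilde H_0\in\mathfrak{su}(N)$ be diagonal, $\tilde H_0=\operatorname{diag}(\mathcal E_1,\dots,\mathcal E_N)$ with real entries ordered as $\mathcal E_1\le\dots\le\mathcal E_N$ (and $\sum_i\mathcal E_i=0$). Let $\Gamma^+=\{(i,j): 1\le i<j\le N,\ b_{ij}\ne 0\}$ be the set of positive roots touched by $B$, where the root attached to $(i,j)$ takes the value $\alpha_{ij}(\tilde H_0)=\mathcal E_j-\mathcal E_i$. Assume that (a) the graph $\mathcal G_B$ with nodes $1,\dots,N$ and arcs $\{(i,j): b_{ij}\neq 0\}$ is connected, and (b) $A$ is $B$-regular, i.e. the numbers $\mathcal E_j-\mathcal E_i$, $(i,j)\in\Gamma^+$, are nonzero and pairwise distinct. Then the system $$\dot X(t)=(A+u(t)B)\,X(t),\qquad X(t)\in SU(N),\qquad X(0)=I,$$ is controllable: for every $\bar X\in SU(N)$ there are a time $T\ge 0$ and a piecewise constant input $u:[0,T]\to\mathbb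 R$ such that the corresponding solution (continuous, and satisfying the equation away from the breakpoints of $u$) satisfies $X(T)=\bar X$. -/

import Mathlib

namespace QuantumControl

/-- The real vector space underlying the Lie algebra `su(N)` of traceless skew-Hermitian complex `N × N` matrices. -/
def su (N : ℕ) : Submodule ℝ (Matrix (Fin N) (Fin N) ℂ) where
  carrier := {M | M.conjTranspose = -M ∧ M.trace = 0}
  add_mem' := by
    rintro a b ⟨ha, ha'⟩ ⟨hb, hb'⟩
    refine ⟨?_, ?_⟩
    · rw [Matrix.conjTranspose_add, ha, hb, neg_add]
    · rw [Matrix.trace_add, ha', hb', add_zero]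
  zero_mem' := by simp
  smul_mem' := by
    rintro c a ⟨ha, ha'⟩
    refine ⟨?_, ?_⟩
    · rw [Matrix.conjTranspose_smul, ha, star_trivial, smul_neg]
    · rw [Matrix.trace_smul, ha', smul_zero]

/-- The `i`-th energy level of a diagonal drift `A = -i H₀`: the `i`-th diagonal entry of the
(real, diagonal) free Hamiltonian `H₀ = i A`. -/
def energy {N : ℕ} (A : Matrix (Fin N) (Fin N) ℂ) (i : Fin N) : ℝ :=
  (Complex.I * A i i).re

/-- The value at `H₀ = i A` of the root attached to the pair `p = (i, j)`, that is, the transition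
`ℰ_j - ℰ_i` between two energy levels. -/
def rootValue {N : ℕ} (A : Matrix (Fin N) (Fin N) ℂ) (p : Fin N × Fin N) : ℝ :=
  energy A p.2 - energy A p.1

/-- The positive roots touched by `B`: the pairs `i < j` with `b_{ij} ≠ 0`. -/
def touchedRoots {N : ℕ} (B : Matrix (Fin N) (Fin N) ℂ) : Set (Fin N × Fin N) :=
  {p | p.1 < p.2 ∧ B p.1 p.2 ≠ 0}

/-- `A` is `B`-regular: the values at `H₀` of the positive roots touched by `B` are nonzero and
pairwise distinct. -/
def IsRegularAlong {N : ℕ} (A B : Matrix (Fin N) (Fin N) ℂ) : Prop :=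
  (∀ p ∈ touchedRoots B, rootValue A p ≠ 0) ∧ Set.InjOn (rootValue A) (touchedRoots B)

/-- The directed graph of a square matrix: there is an arc from `i` to `j` iff `b_{ij} ≠ 0`. -/
def matrixGraph {N : ℕ} (B : Matrix (Fin N) (Fin N) ℂ) : Digraph (Fin N) where
  Adj i j := B i j ≠ 0

/-- `u` is piecewise constant with breakpoints in the finite set `D`: it is constant on every
interval that avoids `D`. -/
def IsPiecewiseConstant (u : ℝ → ℝ) (D : Finset ℝ) : Prop :=
  ∀ s t : ℝ, s ≤ t → (∀ d ∈ D, d ∉ Set.Icc s t) → u s = u t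

/-- `X` is the integral curve on `[0, T]` of `X' = (A + u B) X`, `X 0 = I`, in `SU(N)`, for an input
`u` with breakpoints in `D`: it is continuous and solves the equation off `D`
(the derivative is taken entrywise). -/
def IsIntegralCurve {N : ℕ} (A B : Matrix (Fin N) (Fin N) ℂ) (u : ℝ → ℝ) (D : Finset ℝ) (T : ℝ)
    (X : ℝ → Matrix.specialUnitaryGroup (Fin N) ℂ) : Prop :=
  X 0 = 1 ∧ ContinuousOn X (Set.Icc 0 T) ∧
    ∀ t ∈ Set.Ioo 0 T, t ∉ D → ∀ i j : Fin N,
      HasDerivAt (fun s => (X s : Matrix (Fin N) (Fin N) ℂ) i j)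
        (((A + u t • B) * (X t : Matrix (Fin N) (Fin N) ℂ)) i j) t

/-- The set of all points of `SU(N)` that are reached from the identity in some time `T ≥ 0` along
an integral curve of `X' = (A + u B) X` with a piecewise constant input `u`. -/
def reachableSet {N : ℕ} (A B : Matrix (Fin N) (Fin N) ℂ) :
    Set (Matrix.specialUnitaryGroup (Fin N) ℂ) :=
  {Y | ∃ T : ℝ, 0 ≤ T ∧ ∃ (u : ℝ → ℝ) (D : Finset ℝ)
      (X : ℝ → Matrix.specialUnitaryGroup (Fin N) ℂ),
    IsPiecewiseConstant u D ∧ IsIntegralCurve A B u D T X ∧ X T = Y}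

/-- The system `X' = (A + u B) X` on `SU(N)` is (globally) controllable. -/
def IsControllable {N : ℕ} (A B : Matrix (Fin N) (Fin N) ℂ) : Prop :=
  reachableSet A B = Set.univ

end QuantumControl

/-!
The forward flows of the matrices `A + c B` generate a monoid inside `SU(N)`, and the task is to
show that it is everything. The conjugates of the `A + c B` by the monoid span a subspace which, by
finite dimension, is also stable under the backward flows, hence under brackets: it contains the Lie
algebra generated by `A` and `B`. That algebra is `su(N)`. Indeed `(ad A) ^ 2` scales the entry
`(i, j)` by `-(ℰ_j - ℰ_i) ^ 2`, and since these squares separate the touched roots, polynomials in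
`(ad A) ^ 2` cut `B` into its root components; brackets along walks in the graph of `B` then produce
the remaining ones.

Following the flows one after the other gives a family of elements of the monoid whose velocities
span `su(N)`, so the monoid has nonempty interior. In a compact group the closure of a submonoid is
a subgroup; it is open here, hence is the whole connected group, and a dense submonoid with nonempty
interior is the whole group.
-/

namespace QuantumControl

open Filter Matrix NormedSpace
open scoped Pointwise Topology

attribute [local instance] LieRing.ofAssociativeRing

theorem submonoid_eq_top_of_interior_nonempty {G : Type*} [Group G] [TopologicalSpace G]
    [IsTopologicalGroup G] [CompactSpace G] [PreconnectedSpace G] {S : Submonoid G}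
    (hS : (interior (S : Set G)).Nonempty) : S = ⊤ := by
  have hclosure : closure (S : Set G) = (Subgroup.closure (S : Set G)).topologicalClosure := by
    simpa using closure_submonoidClosure_eq_closure_subgroupClosure (S : Set G)
  obtain ⟨y, hy⟩ := hS
  have hopen : IsOpen (closure (S : Set G)) := by
    rw [hclosure]
    refine Subgroup.isOpen_of_mem_nhds _ (g := y) ?_
    rw [← hclosure]
    exact mem_of_superset (mem_interior_iff_mem_nhds.1 hy) subset_closure
  have hdense : closure (S : Set G) = Set.univ :=
    IsClopen.eq_univ ⟨isClosed_closure, hopen⟩ ⟨y, subset_closure (interior_subset hy)⟩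
  refine (Submonoid.eq_top_iff' S).2 fun g ↦ ?_
  have hg : g ∈ interior (S : Set G) * closure (S : Set G) := by
    rw [hdense]
    exact ⟨y, hy, y⁻¹ * g, trivial, mul_inv_cancel_left y g⟩
  rw [isOpen_interior.mul_closure] at hg
  obtain ⟨a, ha, b, hb, rfl⟩ := hg
  exact S.mul_mem (interior_subset ha) hb

theorem mem_of_hasDerivAt {E : Type*} [NormedAddCommGroup E] [NormedSpace ℝ E]
    [FiniteDimensional ℝ E] {W : Submodule ℝ E} {f : ℝ → E} {f' : E} {t : ℝ}
    (hf : HasDerivAt f f' t) (hW : ∀ s, f s ∈ W) : f' ∈ W :=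
  W.closed_of_finiteDimensional.mem_of_tendsto hf.tendsto_slope <|
    Eventually.of_forall fun s ↦ W.smul_mem _ (W.sub_mem (hW s) (hW t))

section OrbitSpan

variable {k G V : Type*} [AddCommGroup V]

/-- The span of the orbits of the vectors in `𝒞` under a submonoid `S` of the group acting on `V`
through `ρ`. -/
def orbitSpan [Monoid G] [CommRing k] [Module k V] (ρ : Representation k G V) (S : Submonoid G)
    (𝒞 : Set V) : Submodule k V :=
  Submodule.span k {x | ∃ g ∈ S, ∃ C ∈ 𝒞, ρ g C = x}

theorem subset_orbitSpan [Monoid G] [CommRing k] [Module k V] (ρ : Representation k G V)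
    (S : Submonoid G) (𝒞 : Set V) : 𝒞 ⊆ orbitSpan ρ S 𝒞 := fun C hC ↦
  Submodule.subset_span ⟨1, S.one_mem, C, hC, by simp⟩

theorem apply_mem_orbitSpan [Monoid G] [CommRing k] [Module k V] {ρ : Representation k G V}
    {S : Submonoid G} {𝒞 : Set V} {g : G} (hg : g ∈ S) {x : V} (hx : x ∈ orbitSpan ρ S 𝒞) :
    ρ g x ∈ orbitSpan ρ S 𝒞 := by
  suffices orbitSpan ρ S 𝒞 ≤ (orbitSpan ρ S 𝒞).comap (ρ g) from this hx
  refine Submodule.span_le.2 ?_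
  rintro _ ⟨h, hh, C, hC, rfl⟩
  exact Submodule.subset_span ⟨g * h, S.mul_mem hg hh, C, hC, by simp⟩

variable [Group G] [Field k] [Module k V] [FiniteDimensional k V]

theorem inv_apply_mem_of_forall_apply_mem {ρ : Representation k G V} {W : Submodule k V} {g : G}
    (hW : ∀ x ∈ W, ρ g x ∈ W) {x : V} (hx : x ∈ W) : ρ g⁻¹ x ∈ W := by
  have hinj : Function.Injective ((ρ g).restrict hW) :=
    (LinearMap.injective_restrict_iff hW).2
      (by simpa only [LinearMap.ker_eq_bot.2 (ρ.apply_bijective g).1] using disjoint_bot_right)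
  obtain ⟨y, hy⟩ := LinearMap.injective_iff_surjective.1 hinj ⟨x, hx⟩
  have hxy : x = ρ g y := congrArg Subtype.val hy.symm
  rw [hxy, ρ.inv_self_apply]
  exact y.2

theorem inv_apply_mem_orbitSpan {ρ : Representation k G V} {S : Submonoid G} {𝒞 : Set V} {g : G}
    (hg : g ∈ S) {x : V} (hx : x ∈ orbitSpan ρ S 𝒞) : ρ g⁻¹ x ∈ orbitSpan ρ S 𝒞 :=
  inv_apply_mem_of_forall_apply_mem (fun _ ↦ apply_mem_orbitSpan hg) hx

theorem orbitSpan_le_of_forall_mul_apply_mem {ρ : Representation k G V} {S : Submonoid G}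
    {𝒞 : Set V} {L : Submodule k V} {g : G} (hg : g ∈ S)
    (hL : ∀ s ∈ S, ∀ C ∈ 𝒞, ρ (g * s) C ∈ L) : orbitSpan ρ S 𝒞 ≤ L := by
  have hle : orbitSpan ρ S 𝒞 ≤ L.comap (ρ g) := by
    refine Submodule.span_le.2 ?_
    rintro _ ⟨s, hs, C, hC, rfl⟩
    simpa using hL s hs C hC
  intro x hx
  simpa using hle (inv_apply_mem_orbitSpan hg hx)

end OrbitSpan

section Conjugation

variable {k G 𝔸 : Type*} [Group G]

/-- The representation of `G` on `𝔸` by conjugation, `g ↦ (x ↦ ι g * x * ι g⁻¹)`, attached to a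
homomorphism `ι` from `G` to the multiplicative monoid of `𝔸`. -/
def conjRep (k : Type*) [CommRing k] [Ring 𝔸] [Algebra k 𝔸] (ι : G →* 𝔸) :
    Representation k G 𝔸 where
  toFun g := LinearMap.mulLeftRight k (ι g, ι g⁻¹)
  map_one' := by ext; simp
  map_mul' g h := by ext; simp [mul_assoc]

@[simp]
theorem conjRep_apply [CommRing k] [Ring 𝔸] [Algebra k 𝔸] (ι : G →* 𝔸) (g : G) (x : 𝔸) :
    conjRep k ι g x = ι g * x * ι g⁻¹ := rfl

theorem map_mul_map_inv [Monoid 𝔸] (ι : G →* 𝔸) (g : G) : ι g * ι g⁻¹ = 1 := by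
  rw [← map_mul, mul_inv_cancel, map_one]

theorem map_inv_mul_map [Monoid 𝔸] (ι : G →* 𝔸) (g : G) : ι g⁻¹ * ι g = 1 := by
  rw [← map_mul, inv_mul_cancel, map_one]

theorem conjRep_apply_mul_map [CommRing k] [Ring 𝔸] [Algebra k 𝔸] (ι : G →* 𝔸) (g : G) (x : 𝔸) :
    conjRep k ι g x * ι g = ι g * x := by
  rw [conjRep_apply, mul_assoc, map_inv_mul_map, mul_one]

theorem conjRep_apply_lie [CommRing k] [Ring 𝔸] [Algebra k 𝔸] (ι : G →* 𝔸) (g : G) (x y : 𝔸) :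
    conjRep k ι g ⁅x, y⁆ = ⁅conjRep k ι g x, conjRep k ι g y⁆ := by
  have hcancel (a b : 𝔸) : ι g * a * ι g⁻¹ * (ι g * b * ι g⁻¹) = ι g * (a * b) * ι g⁻¹ := by
    simp only [mul_assoc, ← mul_assoc (ι g⁻¹) (ι g), map_inv_mul_map, one_mul]
  simp only [conjRep_apply, Ring.lie_def, hcancel, mul_sub, sub_mul]

end Conjugation

section Flows

variable {G 𝔸 : Type*} [Group G] [NormedRing 𝔸] [NormedAlgebra ℝ 𝔸] {ι : G →* 𝔸} {𝒞 : Set 𝔸}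

/-- The monoid generated by the elements of `G` that are mapped by `ι` to the forward flows
`exp (t • C)`, `0 ≤ t`, of the elements `C` of `𝒞`. -/
def flowMonoid (ι : G →* 𝔸) (𝒞 : Set 𝔸) : Submonoid G :=
  Submonoid.closure {g | ∃ C ∈ 𝒞, ∃ t : ℝ, 0 ≤ t ∧ ι g = exp (t • C)}

theorem mem_flowMonoid {g : G} {C : 𝔸} (hC : C ∈ 𝒞) {t : ℝ} (ht : 0 ≤ t)
    (hg : ι g = exp (t • C)) : g ∈ flowMonoid ι 𝒞 :=
  Submonoid.subset_closure ⟨C, hC, t, ht, hg⟩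

variable [FiniteDimensional ℝ 𝔸]

theorem map_inv_eq_exp_neg {g : G} {x : 𝔸} (hg : ι g = exp x) : ι g⁻¹ = exp (-x) := by
  have := FiniteDimensional.complete ℝ 𝔸
  let := NormedAlgebra.restrictScalars ℚ ℝ 𝔸
  refine left_inv_eq_right_inv (map_inv_mul_map ι g) ?_
  rw [hg, ← exp_add_of_commute (Commute.refl x).neg_right, add_neg_cancel, exp_zero]

theorem exp_smul_mul_mul_exp_smul_neg_mem_orbitSpan {C : 𝔸} (hC : C ∈ 𝒞)
    (hexp : ∀ t : ℝ, exp (t • C) ∈ Set.range ι) {y : 𝔸}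
    (hy : y ∈ orbitSpan (conjRep ℝ ι) (flowMonoid ι 𝒞) 𝒞) (t : ℝ) :
    exp (t • C) * y * exp (t • -C) ∈ orbitSpan (conjRep ℝ ι) (flowMonoid ι 𝒞) 𝒞 := by
  rcases le_total 0 t with ht | ht
  · obtain ⟨g, hg⟩ := hexp t
    have hmem := apply_mem_orbitSpan (mem_flowMonoid hC ht hg) hy
    rwa [conjRep_apply, map_inv_eq_exp_neg hg, hg, ← smul_neg] at hmem
  · obtain ⟨g, hg⟩ := hexp (-t)
    have hmem := inv_apply_mem_orbitSpan (mem_flowMonoid hC (neg_nonneg.2 ht) hg) hy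
    rwa [conjRep_apply, map_inv_eq_exp_neg hg, inv_inv, hg, neg_smul, neg_neg, ← smul_neg] at hmem

theorem lie_mem_orbitSpan_of_mem {C : 𝔸} (hC : C ∈ 𝒞)
    (hexp : ∀ t : ℝ, exp (t • C) ∈ Set.range ι) {y : 𝔸}
    (hy : y ∈ orbitSpan (conjRep ℝ ι) (flowMonoid ι 𝒞) 𝒞) :
    ⁅C, y⁆ ∈ orbitSpan (conjRep ℝ ι) (flowMonoid ι 𝒞) 𝒞 := by
  have := FiniteDimensional.complete ℝ 𝔸
  have hderiv : HasDerivAt (fun t : ℝ ↦ exp (t • C) * y * exp (t • -C)) ⁅C, y⁆ 0 := by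
    refine (((hasDerivAt_exp_smul_const C (0 : ℝ)).mul_const y).mul
      (hasDerivAt_exp_smul_const (-C) (0 : ℝ))).congr_deriv ?_
    simp only [zero_smul, exp_zero, one_mul, mul_one, mul_neg, Ring.lie_def, sub_eq_add_neg]
  exact mem_of_hasDerivAt hderiv (exp_smul_mul_mul_exp_smul_neg_mem_orbitSpan hC hexp hy)

theorem lie_mem_orbitSpan (hexp : ∀ C ∈ 𝒞, ∀ t : ℝ, exp (t • C) ∈ Set.range ι) {x y : 𝔸}
    (hx : x ∈ orbitSpan (conjRep ℝ ι) (flowMonoid ι 𝒞) 𝒞)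
    (hy : y ∈ orbitSpan (conjRep ℝ ι) (flowMonoid ι 𝒞) 𝒞) :
    ⁅x, y⁆ ∈ orbitSpan (conjRep ℝ ι) (flowMonoid ι 𝒞) 𝒞 := by
  induction hx using Submodule.span_induction with
  | mem x hx =>
    obtain ⟨g, hg, C, hC, rfl⟩ := hx
    have hmem := apply_mem_orbitSpan hg
      (lie_mem_orbitSpan_of_mem hC (hexp C hC) (inv_apply_mem_orbitSpan hg hy))
    rwa [conjRep_apply_lie, Representation.self_inv_apply] at hmem
  | zero => simp only [zero_lie, Submodule.zero_mem]
  | add a b _ _ ha hb => simpa only [add_lie] using Submodule.add_mem _ ha hb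
  | smul r a _ ha => simpa only [smul_lie] using Submodule.smul_mem _ r ha

theorem lieSpan_le_orbitSpan (hexp : ∀ C ∈ 𝒞, ∀ t : ℝ, exp (t • C) ∈ Set.range ι) :
    (LieSubalgebra.lieSpan ℝ 𝔸 𝒞).toSubmodule ≤ orbitSpan (conjRep ℝ ι) (flowMonoid ι 𝒞) 𝒞 := by
  let W : LieSubalgebra ℝ 𝔸 :=
    { orbitSpan (conjRep ℝ ι) (flowMonoid ι 𝒞) 𝒞 with lie_mem' := lie_mem_orbitSpan hexp }
  have hle : LieSubalgebra.lieSpan ℝ 𝔸 𝒞 ≤ W :=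
    LieSubalgebra.lieSpan_le.2 (subset_orbitSpan (conjRep ℝ ι) (flowMonoid ι 𝒞) 𝒞)
  exact hle

/-- `L` is a velocity space of `S`: some map `f : L → G`, with values in `S` near `0`, has the
derivative `v ↦ v * ι (f 0)` at `0`. Thus `L` consists of right-translated velocities, at `f 0`,
of families of elements of `S`. -/
def IsVelocitySpace (ι : G →* 𝔸) (S : Set G) (L : Submodule ℝ 𝔸) : Prop :=
  ∃ f : L → G, (∀ᶠ v in 𝓝 0, f v ∈ S) ∧
    HasStrictFDerivAt (fun v ↦ ι (f v))
      ((ContinuousLinearMap.mul ℝ 𝔸).flip (ι (f 0)) ∘L L.subtypeL) 0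

theorem isVelocitySpace_range {E : Type*} [NormedAddCommGroup E] [NormedSpace ℝ E] {S : Set G}
    {f : E → G} {p : E} {R : E →L[ℝ] 𝔸} (hfS : ∀ᶠ x in 𝓝 p, f x ∈ S)
    (hf : HasStrictFDerivAt (fun x ↦ ι (f x))
      ((ContinuousLinearMap.mul ℝ 𝔸).flip (ι (f p)) ∘L R) p) :
    IsVelocitySpace ι S (R : E →ₗ[ℝ] 𝔸).range := by
  obtain ⟨σ, hσ⟩ := R.rangeRestrict.exists_rightInverse_of_surjective
    (LinearMap.range_rangeRestrict (R : E →ₗ[ℝ] 𝔸))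
  have hRσ (v : (R : E →ₗ[ℝ] 𝔸).range) : R (σ v) = v :=
    congrArg Subtype.val (DFunLike.congr_fun hσ v)
  have hq0 : p + σ 0 = p := by rw [map_zero, add_zero]
  have hq : HasStrictFDerivAt (fun v ↦ p + σ v) σ 0 := σ.hasStrictFDerivAt.const_add p
  rw [← hq0] at hfS hf
  refine ⟨fun v ↦ f (p + σ v), hq.continuousAt.eventually hfS, ?_⟩
  refine (hf.comp 0 hq).congr_fderiv (ContinuousLinearMap.ext fun v ↦ ?_)
  simp [hRσ]

omit [FiniteDimensional ℝ 𝔸] in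
theorem isVelocitySpace_bot {S : Set G} {g : G} (hg : g ∈ S) : IsVelocitySpace ι S ⊥ := by
  refine ⟨fun _ ↦ g, Eventually.of_forall fun _ ↦ hg, ?_⟩
  convert hasStrictFDerivAt_const (𝕜 := ℝ) (ι g) (0 : (⊥ : Submodule ℝ 𝔸)) using 1
  exact Subsingleton.elim _ _

omit [FiniteDimensional ℝ 𝔸] in
theorem hasStrictFDerivAt_mul_mul_exp_smul [CompleteSpace 𝔸] {E : Type*} [NormedAddCommGroup E]
    [NormedSpace ℝ E] {F : E → 𝔸} {p : E} {R : E →L[ℝ] 𝔸}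
    (hF : HasStrictFDerivAt F ((ContinuousLinearMap.mul ℝ 𝔸).flip (F p) ∘L R) p) {a C Z : 𝔸}
    (hZ : Z * (F p * a) = F p * a * C) (t : ℝ) :
    HasStrictFDerivAt (fun x : E × ℝ ↦ F x.1 * a * exp (x.2 • C))
      ((ContinuousLinearMap.mul ℝ 𝔸).flip (F p * a * exp (t • C)) ∘L
        R.coprod (ContinuousLinearMap.toSpanSingleton ℝ Z)) (p, t) := by
  have hfst : HasStrictFDerivAt (fun x : E × ℝ ↦ F x.1) _ (p, t) :=
    HasStrictFDerivAt.comp _ (g := F) hF hasStrictFDerivAt_fst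
  have hsnd : HasStrictFDerivAt (fun x : E × ℝ ↦ exp (x.2 • C)) _ (p, t) :=
    HasStrictFDerivAt.comp _ (g := fun t : ℝ ↦ exp (t • C))
      (hasStrictDerivAt_exp_smul_const' C t).hasStrictFDerivAt hasStrictFDerivAt_snd
  refine ((hfst.mul_const' a).mul' hsnd).congr_fderiv (ContinuousLinearMap.ext fun v ↦ ?_)
  suffices F p * a * (v.2 • (C * exp (t • C))) + R v.1 * F p * a * exp (t • C) =
      R v.1 * F p * a * exp (t • C) + v.2 • (Z * (F p * a) * exp (t • C)) by
    simpa [mul_assoc, add_mul] using this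
  rw [hZ, mul_smul_comm, add_comm]
  simp only [mul_assoc]

/-- Following a family with velocities `L` by `s` and then by the flow of `C` adds the conjugate of
`C` to its velocities. -/
theorem IsVelocitySpace.exists_sup_span (hexp : ∀ C ∈ 𝒞, ∀ t : ℝ, exp (t • C) ∈ Set.range ι)
    {L : Submodule ℝ 𝔸} (hL : IsVelocitySpace ι (flowMonoid ι 𝒞) L) :
    ∃ g ∈ flowMonoid ι 𝒞, ∀ s ∈ flowMonoid ι 𝒞, ∀ C ∈ 𝒞,
      IsVelocitySpace ι (flowMonoid ι 𝒞) (L ⊔ ℝ ∙ conjRep ℝ ι (g * s) C) := by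
  obtain ⟨f, hfS, hf⟩ := hL
  refine ⟨f 0, hfS.self_of_nhds, fun s hs C hC ↦ ?_⟩
  choose γ hγ using hexp C hC
  let Z := conjRep ℝ ι (f 0 * s) C
  let R : L × ℝ →L[ℝ] 𝔸 := L.subtypeL.coprod (ContinuousLinearMap.toSpanSingleton ℝ Z)
  have hR : (R : L × ℝ →ₗ[ℝ] 𝔸).range = L ⊔ ℝ ∙ Z := by
    simp only [R, ContinuousLinearMap.coe_coprod, LinearMap.range_coprod]
    congr 1
    · exact L.range_subtype
    · exact (LinearMap.span_singleton_eq_range ℝ 𝔸 Z).symm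
  rw [← hR]
  refine isVelocitySpace_range (f := fun x : L × ℝ ↦ f x.1 * s * γ x.2) (p := (0, 1)) ?_ ?_
  · have hfst := (continuous_fst.tendsto ((0 : L), (1 : ℝ))).eventually hfS
    have hsnd := (continuous_snd.tendsto ((0 : L), (1 : ℝ))).eventually (lt_mem_nhds one_pos)
    filter_upwards [hfst, hsnd] with x hx ht
    exact mul_mem (mul_mem hx hs) (mem_flowMonoid hC ht.le (hγ x.2))
  · have hZ : Z * (ι (f 0) * ι s) = ι (f 0) * ι s * C := by
      simpa only [← map_mul] using conjRep_apply_mul_map ι (f 0 * s) C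
    simp only [map_mul, hγ]
    exact hasStrictFDerivAt_mul_mul_exp_smul hf hZ 1

theorem exists_isVelocitySpace_orbitSpan_le
    (hexp : ∀ C ∈ 𝒞, ∀ t : ℝ, exp (t • C) ∈ Set.range ι) :
    ∃ L, IsVelocitySpace ι (flowMonoid ι 𝒞) L ∧
      orbitSpan (conjRep ℝ ι) (flowMonoid ι 𝒞) 𝒞 ≤ L := by
  obtain ⟨L, hL, hmax⟩ := exists_maximal_of_wellFoundedGT (IsVelocitySpace ι (flowMonoid ι 𝒞))
    ⟨⊥, isVelocitySpace_bot (flowMonoid ι 𝒞).one_mem⟩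
  obtain ⟨g, hg, hsup⟩ := hL.exists_sup_span hexp
  refine ⟨L, hL, orbitSpan_le_of_forall_mul_apply_mem hg fun s hs C hC ↦ ?_⟩
  exact hmax (hsup s hs C hC) le_sup_left
    (Submodule.mem_sup_right (Submodule.mem_span_singleton_self _))

/-- `𝔤` plays the role of the Lie algebra of the group embedded in `𝔸` by `ι`: the exponential maps
it to the group and, near `0`, maps nothing else there. -/
structure IsLieAlgebraOf (ι : G →* 𝔸) (𝔤 : Submodule ℝ 𝔸) : Prop where
  exp_mem_range : ∀ X ∈ 𝔤, exp X ∈ Set.range ι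
  eventually_mem : ∀ᶠ X in 𝓝 (0 : 𝔸), exp X ∈ Set.range ι → X ∈ 𝔤

theorem map_exp_mul_nhds {L Q : Submodule ℝ 𝔸} (hLQ : L ⊔ Q = ⊤) {f : L → G}
    (hf : HasStrictFDerivAt (fun v ↦ ι (f v))
      ((ContinuousLinearMap.mul ℝ 𝔸).flip (ι (f 0)) ∘L L.subtypeL) 0) :
    map (fun x : L × Q ↦ exp (x.2 : 𝔸) * ι (f x.1)) (𝓝 (0, 0)) = 𝓝 (ι (f 0)) := by
  have := FiniteDimensional.complete ℝ 𝔸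
  have hfst : HasStrictFDerivAt (fun x : L × Q ↦ ι (f x.1)) _ (0, 0) :=
    HasStrictFDerivAt.comp _ (g := fun v ↦ ι (f v)) hf hasStrictFDerivAt_fst
  have hsnd : HasStrictFDerivAt (fun x : L × Q ↦ exp (x.2 : 𝔸))
      (Q.subtypeL ∘L ContinuousLinearMap.snd ℝ L Q) (0, 0) :=
    HasStrictFDerivAt.comp _ (f := fun x : L × Q ↦ (x.2 : 𝔸)) (g := exp)
      (g' := (1 : 𝔸 →L[ℝ] 𝔸)) hasStrictFDerivAt_exp_zero
      (Q.subtypeL ∘L ContinuousLinearMap.snd ℝ L Q).hasStrictFDerivAt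
  refine ((hsnd.mul' hfst).map_nhds_eq_of_surj (LinearMap.range_eq_top.2 fun Y ↦ ?_)).trans ?_
  · have hY : Y * ι (f 0)⁻¹ ∈ L ⊔ Q := hLQ ▸ Submodule.mem_top
    obtain ⟨X, hX, P, hP, hXP⟩ := Submodule.mem_sup.1 hY
    refine ⟨(⟨X, hX⟩, ⟨P, hP⟩), ?_⟩
    simp [← add_mul, hXP, mul_assoc, map_inv_mul_map]
  · simp

/-- A complement `Q` of `𝔤` completes the family `f` to a submersion `(v, P) ↦ exp P * ι (f v)` onto
a neighbourhood in `𝔸`. Its values in the group have `P ∈ 𝔤 ⊓ Q = ⊥`, hence come from `S`. -/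
theorem IsVelocitySpace.interior_nonempty [TopologicalSpace G] (hcont : Continuous ι)
    (hinj : Function.Injective ι) {𝔤 L : Submodule ℝ 𝔸} {S : Set G} (h𝔤 : IsLieAlgebraOf ι 𝔤)
    (hL : IsVelocitySpace ι S L) (hle : 𝔤 ≤ L) : (interior S).Nonempty := by
  obtain ⟨f, hfS, hf⟩ := hL
  obtain ⟨Q, hQ⟩ := 𝔤.exists_isCompl
  have hsubmersion := map_exp_mul_nhds
    (top_unique (hQ.sup_eq_top.ge.trans (sup_le_sup_right hle Q))) hf
  have hev : ∀ᶠ x : L × Q in 𝓝 (0, 0), f x.1 ∈ S ∧ (exp (x.2 : 𝔸) ∈ Set.range ι → (x.2 : 𝔸) ∈ 𝔤) :=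
    ((continuous_fst.tendsto ((0 : L), (0 : Q))).eventually hfS).and
      (((by fun_prop : Continuous fun x : L × Q ↦ (x.2 : 𝔸)).tendsto' (0, 0) 0 rfl).eventually
        h𝔤.eventually_mem)
  refine ⟨f 0, mem_interior_iff_mem_nhds.2 ?_⟩
  have himage := image_mem_map (m := fun x : L × Q ↦ exp (x.2 : 𝔸) * ι (f x.1)) hev
  rw [hsubmersion] at himage
  filter_upwards [hcont.continuousAt.preimage_mem_nhds himage]
  rintro y ⟨⟨v, P⟩, ⟨hv, hP⟩, hy : exp (P : 𝔸) * ι (f v) = ι y⟩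
  have hexpP : exp (P : 𝔸) = ι (y * (f v)⁻¹) := by
    rw [map_mul, ← hy, mul_assoc, map_mul_map_inv, mul_one]
  have hP0 : (P : 𝔸) = 0 :=
    Submodule.disjoint_def.1 hQ.disjoint _ (hP ⟨_, hexpP.symm⟩) P.2
  rw [hP0, exp_zero, one_mul] at hy
  exact hinj hy ▸ hv

theorem interior_flowMonoid_nonempty [TopologicalSpace G] (hcont : Continuous ι)
    (hinj : Function.Injective ι) {𝔤 : Submodule ℝ 𝔸} (h𝔤 : IsLieAlgebraOf ι 𝔤) (h𝒞 : 𝒞 ⊆ 𝔤)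
    (hspan : 𝔤 ≤ (LieSubalgebra.lieSpan ℝ 𝔸 𝒞).toSubmodule) :
    (interior (flowMonoid ι 𝒞 : Set G)).Nonempty := by
  have hexp (C : 𝔸) (hC : C ∈ 𝒞) (t : ℝ) : exp (t • C) ∈ Set.range ι :=
    h𝔤.exp_mem_range _ (𝔤.smul_mem t (h𝒞 hC))
  obtain ⟨L, hL, hle⟩ := exists_isVelocitySpace_orbitSpan_le hexp
  exact hL.interior_nonempty hcont hinj h𝔤 ((hspan.trans (lieSpan_le_orbitSpan hexp)).trans hle)

theorem flowMonoid_eq_top [TopologicalSpace G] [IsTopologicalGroup G] [CompactSpace G]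
    [PreconnectedSpace G] (hcont : Continuous ι) (hinj : Function.Injective ι)
    {𝔤 : Submodule ℝ 𝔸} (h𝔤 : IsLieAlgebraOf ι 𝔤) (h𝒞 : 𝒞 ⊆ 𝔤)
    (hspan : 𝔤 ≤ (LieSubalgebra.lieSpan ℝ 𝔸 𝒞).toSubmodule) : flowMonoid ι 𝒞 = ⊤ :=
  submonoid_eq_top_of_interior_nonempty
    (interior_flowMonoid_nonempty hcont hinj h𝔤 h𝒞 hspan)

end Flows

section Exponential

theorem exists_mem_nhds_zero_injOn_exp (𝔸 : Type*) [NormedRing 𝔸] [NormedAlgebra ℝ 𝔸]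
    [CompleteSpace 𝔸] : ∃ V ∈ 𝓝 (0 : 𝔸), Set.InjOn exp V := by
  have hderiv : HasStrictFDerivAt exp (ContinuousLinearEquiv.refl ℝ 𝔸 : 𝔸 →L[ℝ] 𝔸) 0 :=
    hasStrictFDerivAt_exp_zero
  exact ⟨_, (hderiv.toOpenPartialHomeomorph exp).open_source.mem_nhds
    hderiv.mem_toOpenPartialHomeomorph_source, (hderiv.toOpenPartialHomeomorph exp).injOn⟩

theorem eventually_mem_skewAdjoint_of_exp_mem_unitary (𝔸 : Type*) [NormedRing 𝔸]
    [NormedAlgebra ℝ 𝔸] [CompleteSpace 𝔸] [StarRing 𝔸] [ContinuousStar 𝔸] :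
    ∀ᶠ X in 𝓝 (0 : 𝔸), exp X ∈ unitary 𝔸 → X ∈ skewAdjoint 𝔸 := by
  let := NormedAlgebra.restrictScalars ℚ ℝ 𝔸
  obtain ⟨V, hV, hinj⟩ := exists_mem_nhds_zero_injOn_exp 𝔸
  filter_upwards [(continuous_star.tendsto' (0 : 𝔸) 0 (star_zero 𝔸)).eventually hV,
    (continuous_neg.tendsto' (0 : 𝔸) 0 neg_zero).eventually hV] with X hstar hneg hX
  refine skewAdjoint.mem_iff.2 (hinj hstar hneg ?_)
  refine left_inv_eq_right_inv (a := exp X) ?_ ?_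
  · rw [← star_exp, Unitary.star_mul_self_of_mem hX]
  · rw [← exp_add_of_commute (Commute.refl X).neg_right, add_neg_cancel, exp_zero]

theorem eq_zero_of_exp_eq_one_of_norm_lt {z : ℂ} (hexp : Complex.exp z = 1)
    (hz : ‖z‖ < 2 * Real.pi) : z = 0 := by
  obtain ⟨k, rfl⟩ := Complex.exp_eq_one_iff.1 hexp
  have hk : |(k : ℝ)| * (2 * Real.pi) < 1 * (2 * Real.pi) := by
    simpa [abs_of_pos Real.pi_pos] using hz
  have hk' : |k| < 1 := by exact_mod_cast lt_of_mul_lt_mul_right hk Real.two_pi_pos.le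
  simp [Int.abs_lt_one_iff.1 hk']

end Exponential

section SpecialUnitary

open scoped Matrix.Norms.L2Operator

variable {n : Type*} [Fintype n] [DecidableEq n] {U X : Matrix n n ℂ}

theorem exp_unitary_conj_diagonal (hU : U ∈ unitaryGroup n ℂ) (v : n → ℂ) :
    exp (U * diagonal v * star U) = U * diagonal (fun i ↦ Complex.exp (v i)) * star U := by
  have hinv : U⁻¹ = star U := Matrix.inv_eq_left_inv hU.1
  rw [← hinv, Matrix.exp_conj _ _ (IsUnit.of_mul_eq_one _ hU.2), Matrix.exp_diagonal,
    Complex.exp_eq_exp_ℂ]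
  congr 3
  exact funext fun i ↦ Pi.coe_exp v i

theorem trace_unitary_conj (hU : U ∈ unitaryGroup n ℂ) (X : Matrix n n ℂ) :
    (U * X * star U).trace = X.trace := by
  rw [trace_mul_comm, ← mul_assoc, hU.1, one_mul]

theorem exists_unitary_conj_diagonal_of_mem_skewAdjoint (hX : X ∈ skewAdjoint (Matrix n n ℂ)) :
    ∃ U ∈ unitaryGroup n ℂ, ∃ θ : n → ℝ,
      X = U * diagonal (fun i ↦ (θ i : ℂ) * Complex.I) * star U := by
  have hH : (Complex.I • X).IsHermitian := by
    rw [IsHermitian, conjTranspose_smul, ← star_eq_conjTranspose, skewAdjoint.mem_iff.1 hX]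
    simp
  refine ⟨hH.eigenvectorUnitary, hH.eigenvectorUnitary.2, fun i ↦ -hH.eigenvalues i, ?_⟩
  have hdiag : diagonal (fun i ↦ ((-hH.eigenvalues i : ℝ) : ℂ) * Complex.I) =
      -Complex.I • diagonal (RCLike.ofReal ∘ hH.eigenvalues) := by
    rw [← diagonal_smul]
    congr 1
    ext i
    simp [mul_comm]
  have hspec := hH.spectral_theorem
  rw [Unitary.conjStarAlgAut_apply] at hspec
  rw [hdiag, mul_smul_comm, smul_mul_assoc, ← hspec, smul_smul]
  simp

theorem det_exp_of_mem_skewAdjoint (hX : X ∈ skewAdjoint (Matrix n n ℂ)) :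
    (exp X).det = Complex.exp X.trace := by
  obtain ⟨U, hU, θ, rfl⟩ := exists_unitary_conj_diagonal_of_mem_skewAdjoint hX
  rw [exp_unitary_conj_diagonal hU, det_mul_right_comm, hU.2, one_mul, det_diagonal,
    trace_unitary_conj hU, trace_diagonal, Complex.exp_sum]

theorem exp_mem_specialUnitaryGroup_iff (hX : X ∈ skewAdjoint (Matrix n n ℂ)) :
    exp X ∈ specialUnitaryGroup n ℂ ↔ Complex.exp X.trace = 1 := by
  let := NormedAlgebra.restrictScalars ℚ ℝ (Matrix n n ℂ)
  rw [mem_specialUnitaryGroup_iff, det_exp_of_mem_skewAdjoint hX]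
  exact and_iff_right (exp_mem_unitary_of_mem_skewAdjoint hX)

theorem exists_mem_skewAdjoint_exp_eq (hU : U ∈ unitaryGroup n ℂ) :
    ∃ X ∈ skewAdjoint (Matrix n n ℂ), exp X = U := by
  have : IsStarNormal U := ⟨hU.1.trans hU.2.symm⟩
  have hcont (f : ℂ → ℂ) : ContinuousOn f (spectrum ℂ U) :=
    (Matrix.finite_spectrum U).continuousOn f
  let log : ℂ → ℂ := fun z ↦ z.arg * Complex.I
  refine ⟨cfc log U, skewAdjoint.mem_iff.2 ?_, ?_⟩
  · rw [← cfc_star, ← cfc_neg]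
    simp [log]
  · rw [← CFC.complex_exp_eq_normedSpace_exp (cfc_predicate log U),
      ← cfc_comp' Complex.exp log U (by fun_prop) (hcont log)]
    nth_rw 2 [← cfc_id ℂ U]
    refine cfc_congr fun z hz ↦ ?_
    have hnorm : ‖z‖ = 1 := by simpa using spectrum.subset_circle_of_unitary hU hz
    simpa [hnorm] using Complex.norm_mul_exp_arg_mul_I z

variable {N : ℕ}

theorem mem_su_iff {X : Matrix (Fin N) (Fin N) ℂ} :
    X ∈ su N ↔ X ∈ skewAdjoint (Matrix (Fin N) (Fin N) ℂ) ∧ X.trace = 0 := Iff.rfl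

theorem exp_mem_specialUnitaryGroup {X : Matrix (Fin N) (Fin N) ℂ} (hX : X ∈ su N) :
    exp X ∈ specialUnitaryGroup (Fin N) ℂ := by
  rw [exp_mem_specialUnitaryGroup_iff (mem_su_iff.1 hX).1, hX.2, Complex.exp_zero]

theorem eventually_mem_su_of_exp_mem (N : ℕ) : ∀ᶠ X in 𝓝 (0 : Matrix (Fin N) (Fin N) ℂ),
    exp X ∈ specialUnitaryGroup (Fin N) ℂ → X ∈ su N := by
  have htrace : ∀ᶠ X in 𝓝 (0 : Matrix (Fin N) (Fin N) ℂ), ‖X.trace‖ < 2 * Real.pi :=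
    (continuous_id.matrix_trace.norm.tendsto' _ 0 (by simp)).eventually_lt_const Real.two_pi_pos
  filter_upwards [eventually_mem_skewAdjoint_of_exp_mem_unitary (Matrix (Fin N) (Fin N) ℂ),
    htrace] with X hskew hlt hX
  have hX' := hskew hX.1
  exact mem_su_iff.2 ⟨hX', eq_zero_of_exp_eq_one_of_norm_lt
    ((exp_mem_specialUnitaryGroup_iff hX').1 hX) hlt⟩

theorem isLieAlgebraOf_su (N : ℕ) :
    IsLieAlgebraOf (specialUnitaryGroup (Fin N) ℂ).subtype (su N) where
  exp_mem_range X hX := ⟨⟨exp X, exp_mem_specialUnitaryGroup hX⟩, rfl⟩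
  eventually_mem := by
    filter_upwards [eventually_mem_su_of_exp_mem N] with X hX
    rintro ⟨g, hg⟩
    exact hX (hg ▸ g.2)

theorem unitary_conj_diagonal_mem_su {U : Matrix (Fin N) (Fin N) ℂ}
    (hU : U ∈ unitaryGroup (Fin N) ℂ) {θ : Fin N → ℝ} (hθ : ∑ i, θ i = 0) :
    U * diagonal (fun i ↦ (θ i : ℂ) * Complex.I) * star U ∈ su N := by
  refine mem_su_iff.2 ⟨skewAdjoint.conjugate (skewAdjoint.mem_iff.2 ?_) U, ?_⟩
  · rw [star_eq_conjTranspose, diagonal_conjTranspose, diagonal_neg]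
    congr 1
    ext i
    simp
  · rw [trace_unitary_conj hU, trace_diagonal, ← Finset.sum_mul, ← Complex.ofReal_sum, hθ]
    simp

/-- The sum of the angles of a special unitary matrix is a multiple of `2π`, which is subtracted
from one of them. -/
theorem exists_mem_su_exp_eq {g : Matrix (Fin N) (Fin N) ℂ}
    (hg : g ∈ specialUnitaryGroup (Fin N) ℂ) : ∃ X ∈ su N, exp X = g := by
  rcases isEmpty_or_nonempty (Fin N) with _ | ⟨⟨i₀⟩⟩
  · exact ⟨0, (su N).zero_mem, Subsingleton.elim _ _⟩
  obtain ⟨X, hX, rfl⟩ := exists_mem_skewAdjoint_exp_eq hg.1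
  have htrace := (exp_mem_specialUnitaryGroup_iff hX).1 hg
  obtain ⟨U, hU, θ, rfl⟩ := exists_unitary_conj_diagonal_of_mem_skewAdjoint hX
  rw [trace_unitary_conj hU, trace_diagonal, ← Finset.sum_mul, ← Complex.ofReal_sum] at htrace
  obtain ⟨k, hk⟩ := Complex.exp_eq_one_iff.1 htrace
  have hsum : ∑ i, θ i = k * (2 * Real.pi) := by
    rw [← mul_assoc, mul_left_inj' Complex.I_ne_zero] at hk
    exact_mod_cast hk
  refine ⟨_, unitary_conj_diagonal_mem_su hU
    (θ := θ - Pi.single i₀ (k * (2 * Real.pi))) ?_, ?_⟩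
  · simp only [Pi.sub_apply, Finset.sum_sub_distrib, Finset.sum_pi_single', hsum, Finset.mem_univ,
      if_true, sub_self]
  · rw [exp_unitary_conj_diagonal hU, exp_unitary_conj_diagonal hU]
    congr 3
    ext i
    rcases eq_or_ne i i₀ with rfl | hi
    · have hperiod := Complex.exp_int_mul_two_pi_mul_I k
      rw [← mul_assoc] at hperiod
      simp [sub_mul, Complex.exp_sub, hperiod]
    · simp [hi]

theorem image_exp_su (N : ℕ) : exp '' (su N : Set (Matrix (Fin N) (Fin N) ℂ)) =
    specialUnitaryGroup (Fin N) ℂ :=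
  Set.Subset.antisymm (Set.image_subset_iff.2 fun _ ↦ exp_mem_specialUnitaryGroup)
    fun _ ↦ exists_mem_su_exp_eq

instance : PreconnectedSpace (specialUnitaryGroup (Fin N) ℂ) := by
  let := NormedAlgebra.restrictScalars ℚ ℝ (Matrix (Fin N) (Fin N) ℂ)
  refine Subtype.preconnectedSpace ?_
  rw [← image_exp_su]
  exact (su N).convex.isPreconnected.image exp exp_continuous.continuousOn

instance : IsTopologicalGroup (specialUnitaryGroup n ℂ) where
  continuous_inv := (continuous_star.comp continuous_subtype_val).subtype_mk _

theorem isClosed_specialUnitaryGroup (n : Type*) [Fintype n] [DecidableEq n] :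
    IsClosed (specialUnitaryGroup n ℂ : Set (Matrix n n ℂ)) :=
  isClosed_unitary.inter (isClosed_singleton.preimage continuous_id.matrix_det)

instance : CompactSpace (specialUnitaryGroup n ℂ) := by
  have hcube : IsCompact (Set.univ.pi fun _ : n ↦ Set.univ.pi fun _ : n ↦
      Metric.closedBall (0 : ℂ) 1) :=
    isCompact_univ_pi fun _ ↦ isCompact_univ_pi fun _ ↦ isCompact_closedBall _ _
  refine isCompact_iff_compactSpace.1 <|
    hcube.of_isClosed_subset (isClosed_specialUnitaryGroup n) fun M hM i _ j _ ↦ ?_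
  exact mem_closedBall_zero_iff.2 (entry_norm_bound_of_unitary hM.1 i j)

end SpecialUnitary

section SkewSingle

theorem apply_swap_of_conjTranspose_eq_neg {n R : Type*} [Star R] [InvolutiveNeg R]
    {M : Matrix n n R} (hM : Mᴴ = -M) (i j : n) : M j i = -star (M i j) := by
  rw [← conjTranspose_apply, hM, Matrix.neg_apply, neg_neg]

variable {n : Type*} [DecidableEq n]

/-- The elementary skew-Hermitian matrix `z E_ij - z̄ E_ji`, as a real-linear function of `z`. -/
def skewSingle (i j : n) : ℂ →ₗ[ℝ] Matrix n n ℂ :=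
  singleLinearMap ℝ i j - singleLinearMap ℝ j i ∘ₗ Complex.conjAe.toLinearMap

theorem skewSingle_apply (i j : n) (z : ℂ) :
    skewSingle i j z = single i j z - single j i (star z) := rfl

theorem skewSingle_swap (i j : n) (z : ℂ) : skewSingle j i z = -skewSingle i j (star z) := by
  simp [skewSingle_apply]

theorem skewSingle_apply_eq_of {M : Matrix n n ℂ} (hM : Mᴴ = -M) {k l : n} (hkl : k ≠ l) :
    skewSingle k l (M k l) =
      of fun i j ↦ if (i = k ∧ j = l) ∨ (i = l ∧ j = k) then M i j else 0 := by
  ext i j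
  rw [skewSingle_apply, of_apply, Matrix.sub_apply, single_apply, single_apply]
  by_cases hij : i = k ∧ j = l
  · obtain ⟨rfl, rfl⟩ := hij
    simp [hkl.symm]
  · by_cases hji : i = l ∧ j = k
    · obtain ⟨rfl, rfl⟩ := hji
      simp [hkl, apply_swap_of_conjTranspose_eq_neg hM j i]
    · have hij' : ¬(k = i ∧ l = j) := fun h ↦ hij ⟨h.1.symm, h.2.symm⟩
      have hji' : ¬(l = i ∧ k = j) := fun h ↦ hji ⟨h.1.symm, h.2.symm⟩
      simp [hij, hji, hij', hji']

variable [Fintype n]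

theorem lie_skewSingle_skewSingle {i j k : n} (hij : i ≠ j) (hjk : j ≠ k) (hik : i ≠ k)
    (z w : ℂ) : ⁅skewSingle i j z, skewSingle j k w⁆ = skewSingle i k (z * w) := by
  simp [Ring.lie_def, skewSingle_apply, sub_mul, mul_sub, single_mul_single_of_ne, hik, hjk,
    hij, hik.symm, hjk.symm, hij.symm, mul_comm]

theorem lie_skewSingle_one_skewSingle {i j : n} (hij : i ≠ j) (z : ℂ) :
    ⁅skewSingle i j 1, skewSingle i j z⁆ = skewSingle i i z - skewSingle j j z := by
  simp only [Ring.lie_def, skewSingle_apply, sub_mul, mul_sub, star_one, single_mul_single_same,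
    single_mul_single_of_ne, ne_eq, hij, hij.symm, not_false_eq_true, one_mul, mul_one, sub_zero,
    zero_sub]
  abel

theorem sum_skewSingle {M : Matrix n n ℂ} (hM : Mᴴ = -M) :
    ∑ i, ∑ j, skewSingle i j (M i j) = (2 : ℝ) • M := by
  have hsum : ∑ i, ∑ j, single i j (M i j) = M := (matrix_eq_sum_single M).symm
  have hsum_star : ∑ i, ∑ j, single j i (star (M i j)) = -M := by
    rw [Finset.sum_comm, ← hM]
    exact (matrix_eq_sum_single Mᴴ).symm
  simp only [skewSingle_apply, Finset.sum_sub_distrib, hsum, hsum_star, sub_neg_eq_add, two_smul]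

theorem mem_of_forall_skewSingle_mem {W : LieSubalgebra ℝ (Matrix n n ℂ)}
    (hW : ∀ i j, i ≠ j → ∀ z, skewSingle i j z ∈ W) {M : Matrix n n ℂ} (hM : Mᴴ = -M)
    (htr : M.trace = 0) : M ∈ W := by
  rcases isEmpty_or_nonempty n with _ | ⟨⟨o⟩⟩
  · rw [Subsingleton.elim M 0]
    exact W.zero_mem
  have hdiag (i : n) (z : ℂ) : skewSingle i i z - skewSingle o o z ∈ W := by
    rcases eq_or_ne i o with rfl | hio
    · rw [sub_self]
      exact W.zero_mem
    · rw [← lie_skewSingle_one_skewSingle hio]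
      exact W.lie_mem (hW i o hio 1) (hW i o hio z)
  have htrace : ∑ i, skewSingle o o (M i i) = 0 := by
    rw [← map_sum]
    exact (congrArg (skewSingle o o) htr).trans (map_zero _)
  have hrow (i : n) : skewSingle i i (M i i) + ∑ j ∈ Finset.univ.erase i, skewSingle i j (M i j) =
      ∑ j, skewSingle i j (M i j) :=
    Finset.add_sum_erase _ (fun j ↦ skewSingle i j (M i j)) (Finset.mem_univ i)
  have hdecomp : (2 : ℝ) • M = ∑ i, ((skewSingle i i (M i i) - skewSingle o o (M i i)) +
      ∑ j ∈ Finset.univ.erase i, skewSingle i j (M i j)) := by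
    simp only [sub_add_eq_add_sub, Finset.sum_sub_distrib, htrace, sub_zero, hrow,
      sum_skewSingle hM]
  refine (Submodule.smul_mem_iff W.toSubmodule (two_ne_zero' ℝ)).1 (hdecomp ▸ ?_)
  refine Submodule.sum_mem _ fun i _ ↦ Submodule.add_mem _ (hdiag i _) ?_
  exact Submodule.sum_mem _ fun j hj ↦ hW i j (Finset.ne_of_mem_erase hj).symm _

end SkewSingle

section Generation

/-- Interpolation replaces `φ` by a polynomial. -/
theorem of_comp_smul_mem {k V m n : Type*} [Field k] [AddCommGroup V] [Module k V] [Finite m]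
    [Finite n] {W : Submodule k (Matrix m n V)} {c : m → n → k}
    (hW : ∀ Z ∈ W, (of fun i j ↦ c i j • Z i j) ∈ W) (φ : k → k) {Z : Matrix m n V}
    (hZ : Z ∈ W) : (of fun i j ↦ φ (c i j) • Z i j) ∈ W := by
  classical
  have := Fintype.ofFinite m
  have := Fintype.ofFinite n
  have hpoly (p : Polynomial k) : (of fun i j ↦ p.eval (c i j) • Z i j) ∈ W := by
    induction p using Polynomial.induction_on with
    | C a =>
      simp only [Polynomial.eval_C]
      exact W.smul_mem a hZ
    | add p q hp hq =>
      simp only [Polynomial.eval_add, add_smul]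
      exact W.add_mem hp hq
    | monomial d a hd => simpa [pow_succ', mul_smul, smul_comm _ a] using hW _ hd
  let s : Finset k := Finset.univ.image fun p : m × n ↦ c p.1 p.2
  have heval (i : m) (j : n) : (Lagrange.interpolate s id φ).eval (c i j) = φ (c i j) :=
    Lagrange.eval_interpolate_at_node (v := id) φ (Set.injOn_id _)
      (Finset.mem_image_of_mem (fun p : m × n ↦ c p.1 p.2) (Finset.mem_univ (i, j)))
  simpa only [heval] using hpoly (Lagrange.interpolate s id φ)

variable {N : ℕ} {A B : Matrix (Fin N) (Fin N) ℂ}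

theorem apply_self_eq_neg_I_mul_energy (hA : A ∈ su N) (i : Fin N) :
    A i i = -(Complex.I * energy A i) := by
  have hre : (A i i).re = -(A i i).re := by
    simpa using congrArg Complex.re (apply_swap_of_conjTranspose_eq_neg hA.1 i i)
  apply Complex.ext
  · simpa using self_eq_neg.1 hre
  · simp [energy]

theorem lie_apply_of_isDiag (hA : A ∈ su N) (hdiag : A.IsDiag) (Z : Matrix (Fin N) (Fin N) ℂ)
    (i j : Fin N) : ⁅A, Z⁆ i j = Complex.I * rootValue A (i, j) * Z i j := by
  rw [Ring.lie_def, Matrix.sub_apply, ← hdiag.diagonal_diag, diagonal_mul, mul_diagonal, diag_apply,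
    diag_apply, hdiag.diagonal_diag, apply_self_eq_neg_I_mul_energy hA i,
    apply_self_eq_neg_I_mul_energy hA j, rootValue]
  push_cast
  ring

theorem lie_lie_of_isDiag (hA : A ∈ su N) (hdiag : A.IsDiag) (Z : Matrix (Fin N) (Fin N) ℂ) :
    ⁅A, ⁅A, Z⁆⁆ = of fun i j ↦ (-rootValue A (i, j) ^ 2) • Z i j := by
  ext i j
  rw [lie_apply_of_isDiag hA hdiag, lie_apply_of_isDiag hA hdiag, of_apply, Complex.real_smul]
  push_cast
  linear_combination (rootValue A (i, j) ^ 2 * Z i j : ℂ) * Complex.I_sq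

theorem rootValue_swap (A : Matrix (Fin N) (Fin N) ℂ) (i j : Fin N) :
    rootValue A (j, i) = -rootValue A (i, j) := (neg_sub _ _).symm

theorem lie_skewSingle_of_isDiag (hA : A ∈ su N) (hdiag : A.IsDiag) (k l : Fin N) (z : ℂ) :
    ⁅A, skewSingle k l z⁆ = rootValue A (k, l) • skewSingle k l (Complex.I * z) := by
  ext i j
  rw [lie_apply_of_isDiag hA hdiag, Matrix.smul_apply, skewSingle_apply, skewSingle_apply,
    Matrix.sub_apply, Matrix.sub_apply, Complex.real_smul, mul_sub, mul_sub]
  congr 1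
  · by_cases h : k = i ∧ l = j
    · obtain ⟨rfl, rfl⟩ := h
      simp only [single_apply_same]
      ring
    · simp [single_apply_of_ne _ _ _ _ _ h]
  · by_cases h : l = i ∧ k = j
    · obtain ⟨rfl, rfl⟩ := h
      rw [rootValue_swap A k l]
      simp only [single_apply_same, star_mul', Complex.star_def, Complex.conj_I]
      push_cast
      ring
    · simp [single_apply_of_ne _ _ _ _ _ h]

theorem rootValue_pos (hord : Monotone (energy A)) (hreg : IsRegularAlong A B)
    {p : Fin N × Fin N} (hp : p ∈ touchedRoots B) : 0 < rootValue A p :=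
  lt_of_le_of_ne (sub_nonneg.2 (hord hp.1.le)) (hreg.1 p hp).symm

theorem mem_touchedRoots_or_swap_mem (hB : B ∈ su N) {i j : Fin N} (hij : i ≠ j)
    (hb : B i j ≠ 0) : (i, j) ∈ touchedRoots B ∨ (j, i) ∈ touchedRoots B := by
  refine hij.lt_or_gt.imp (fun hlt ↦ ⟨hlt, hb⟩) fun hlt ↦ ⟨hlt, ?_⟩
  simpa [apply_swap_of_conjTranspose_eq_neg hB.1 i j] using hb

theorem rootValue_sq_eq_iff (hB : B ∈ su N) (hord : Monotone (energy A))
    (hreg : IsRegularAlong A B) {k l : Fin N} (hkl : (k, l) ∈ touchedRoots B) {i j : Fin N}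
    (hb : B i j ≠ 0) :
    rootValue A (i, j) ^ 2 = rootValue A (k, l) ^ 2 ↔ (i = k ∧ j = l) ∨ (i = l ∧ j = k) := by
  have hinj {p : Fin N × Fin N} (hp : p ∈ touchedRoots B)
      (hsq : rootValue A p ^ 2 = rootValue A (k, l) ^ 2) : p = (k, l) :=
    hreg.2 hp hkl <|
      (sq_eq_sq₀ (rootValue_pos hord hreg hp).le (rootValue_pos hord hreg hkl).le).1 hsq
  refine ⟨fun hsq ↦ ?_, ?_⟩
  · have hij : i ≠ j := by
      rintro rfl
      have hself : rootValue A (i, i) = 0 := sub_self _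
      rw [hself, zero_pow two_ne_zero, eq_comm, sq_eq_zero_iff] at hsq
      exact hreg.1 _ hkl hsq
    rcases mem_touchedRoots_or_swap_mem hB hij hb with hp | hp
    · exact .inl (Prod.mk.inj (hinj hp hsq))
    · rw [rootValue_swap A j i, neg_sq] at hsq
      exact .inr (Prod.mk.inj (hinj hp hsq)).symm
  · rintro (⟨rfl, rfl⟩ | ⟨rfl, rfl⟩)
    · rfl
    · rw [rootValue_swap A j i, neg_sq]

variable {W : LieSubalgebra ℝ (Matrix (Fin N) (Fin N) ℂ)}

/-- `(ad A) ^ 2` multiplies the entry `(i, j)` by `-ω_ij ^ 2`, and these numbers separate the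
touched roots. -/
theorem skewSingle_apply_mem (hA : A ∈ su N) (hB : B ∈ su N) (hdiag : A.IsDiag)
    (hord : Monotone (energy A)) (hreg : IsRegularAlong A B) (hAW : A ∈ W) (hBW : B ∈ W)
    {k l : Fin N} (hkl : (k, l) ∈ touchedRoots B) : skewSingle k l (B k l) ∈ W := by
  classical
  have hscale (Z : Matrix (Fin N) (Fin N) ℂ) (hZ : Z ∈ W.toSubmodule) :
      (of fun i j ↦ (-rootValue A (i, j) ^ 2) • Z i j) ∈ W.toSubmodule := by
    rw [← lie_lie_of_isDiag hA hdiag]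
    exact W.lie_mem hAW (W.lie_mem hAW hZ)
  let φ : ℝ → ℝ := fun x ↦ if x = -rootValue A (k, l) ^ 2 then 1 else 0
  have hisolate : skewSingle k l (B k l) =
      of fun i j ↦ φ (-rootValue A (i, j) ^ 2) • B i j := by
    rw [skewSingle_apply_eq_of hB.1 hkl.1.ne]
    ext i j
    rcases eq_or_ne (B i j) 0 with hb | hb
    · simp [hb]
    · simp [φ, rootValue_sq_eq_iff hB hord hreg hkl hb]
  rw [hisolate]
  exact of_comp_smul_mem hscale φ hBW

theorem skewSingle_mem_of_mem_touchedRoots (hA : A ∈ su N) (hB : B ∈ su N) (hdiag : A.IsDiag)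
    (hord : Monotone (energy A)) (hreg : IsRegularAlong A B) (hAW : A ∈ W) (hBW : B ∈ W)
    {k l : Fin N} (hkl : (k, l) ∈ touchedRoots B) (z : ℂ) : skewSingle k l z ∈ W := by
  have hmem := skewSingle_apply_mem hA hB hdiag hord hreg hAW hBW hkl
  have hmem_I : skewSingle k l (Complex.I * B k l) ∈ W := by
    have hlie := W.lie_mem hAW hmem
    rw [lie_skewSingle_of_isDiag hA hdiag] at hlie
    exact (Submodule.smul_mem_iff W.toSubmodule (hreg.1 _ hkl)).1 hlie
  have hz : z = (z / B k l).re • B k l + (z / B k l).im • (Complex.I * B k l) := by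
    conv_lhs => rw [← div_mul_cancel₀ z hkl.2, ← Complex.re_add_im (z / B k l)]
    simp only [Complex.real_smul]
    ring
  rw [hz, map_add, map_smul, map_smul]
  exact W.add_mem (W.smul_mem _ hmem) (W.smul_mem _ hmem_I)

theorem skewSingle_mem_of_adj (hA : A ∈ su N) (hB : B ∈ su N) (hdiag : A.IsDiag)
    (hord : Monotone (energy A)) (hreg : IsRegularAlong A B) (hAW : A ∈ W) (hBW : B ∈ W)
    {i j : Fin N} (hij : (matrixGraph B).toSimpleGraphInclusive.Adj i j) (z : ℂ) :
    skewSingle i j z ∈ W := by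
  have hroot : (i, j) ∈ touchedRoots B ∨ (j, i) ∈ touchedRoots B :=
    hij.2.elim (mem_touchedRoots_or_swap_mem hB hij.ne)
      fun hb ↦ (mem_touchedRoots_or_swap_mem hB hij.ne.symm hb).symm
  rcases hroot with hp | hp
  · exact skewSingle_mem_of_mem_touchedRoots hA hB hdiag hord hreg hAW hBW hp z
  · rw [skewSingle_swap]
    exact W.neg_mem (skewSingle_mem_of_mem_touchedRoots hA hB hdiag hord hreg hAW hBW hp _)

/-- Brackets compose the edges along a walk. -/
theorem skewSingle_mem_of_reachable {n : Type*} [Fintype n] [DecidableEq n]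
    {W : LieSubalgebra ℝ (Matrix n n ℂ)} {Γ : SimpleGraph n}
    (hΓ : ∀ i j, Γ.Adj i j → ∀ z, skewSingle i j z ∈ W) {i j : n} (hreach : Γ.Reachable i j)
    (hij : i ≠ j) (z : ℂ) : skewSingle i j z ∈ W := by
  obtain ⟨w⟩ := hreach
  induction w generalizing z with
  | nil => exact absurd rfl hij
  | @cons i k j hik _ ih =>
    rcases eq_or_ne k j with rfl | hkj
    · exact hΓ i k hik z
    · rw [← mul_one z, ← lie_skewSingle_skewSingle hik.ne hkj hij]
      exact W.lie_mem (hΓ i k hik z) (ih hkj 1)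

theorem su_le_of_mem (hA : A ∈ su N) (hB : B ∈ su N) (hdiag : A.IsDiag)
    (hord : Monotone (energy A)) (hconn : (matrixGraph B).toSimpleGraphInclusive.Connected)
    (hreg : IsRegularAlong A B) (hAW : A ∈ W) (hBW : B ∈ W) : su N ≤ W.toSubmodule := by
  rintro M ⟨hM, htr⟩
  refine mem_of_forall_skewSingle_mem (fun i j ↦ ?_) hM htr
  exact skewSingle_mem_of_reachable (fun _ _ ↦ skewSingle_mem_of_adj hA hB hdiag hord hreg hAW hBW)
    (hconn.preconnected i j)

theorem su_le_lieSpan (hA : A ∈ su N) (hB : B ∈ su N) (hdiag : A.IsDiag)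
    (hord : Monotone (energy A)) (hconn : (matrixGraph B).toSimpleGraphInclusive.Connected)
    (hreg : IsRegularAlong A B) :
    su N ≤ (LieSubalgebra.lieSpan ℝ (Matrix (Fin N) (Fin N) ℂ)
      (Set.range fun c : ℝ ↦ A + c • B)).toSubmodule := by
  set 𝔩 := LieSubalgebra.lieSpan ℝ (Matrix (Fin N) (Fin N) ℂ) (Set.range fun c : ℝ ↦ A + c • B)
  have hmem (c : ℝ) : A + c • B ∈ 𝔩 := LieSubalgebra.subset_lieSpan ⟨c, rfl⟩
  have hA𝔩 : A ∈ 𝔩 := by simpa using hmem 0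
  have hB𝔩 : B ∈ 𝔩 := by simpa using 𝔩.sub_mem (hmem 1) hA𝔩
  exact su_le_of_mem hA hB hdiag hord hconn hreg hA𝔩 hB𝔩

end Generation

section Control

open scoped Matrix.Norms.L2Operator

variable {N : ℕ} {A B C : Matrix (Fin N) (Fin N) ℂ} {u : ℝ → ℝ} {D : Finset ℝ} {T : ℝ}

theorem IsPiecewiseConstant.ite_lt (hu : IsPiecewiseConstant u D) (T c : ℝ) :
    IsPiecewiseConstant (fun s ↦ if s < T then u s else c) (insert T D) := by
  intro s t hst hD
  have hT := hD T (Finset.mem_insert_self T D)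
  simp only [Set.mem_Icc, not_and_or, not_le] at hT
  rcases hT with hTs | htT
  · simp [hTs.not_gt, (hTs.trans_le hst).not_gt]
  · simp only [htT, hst.trans_lt htT, if_true]
    exact hu s t hst fun d hd ↦ hD d (Finset.mem_insert_of_mem hd)

theorem IsIntegralCurve.ite_le {X Y : ℝ → specialUnitaryGroup (Fin N) ℂ}
    (hX : IsIntegralCurve A B u D T X) (hT : 0 ≤ T) (hXY : X T = Y T) (hY : Continuous Y) {c : ℝ}
    (hY' : ∀ t i j, HasDerivAt (fun s ↦ (Y s : Matrix (Fin N) (Fin N) ℂ) i j)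
      (((A + c • B) * (Y t : Matrix (Fin N) (Fin N) ℂ)) i j) t) (T' : ℝ) :
    IsIntegralCurve A B (fun s ↦ if s < T then u s else c) (insert T D) T'
      (fun s ↦ if s ≤ T then X s else Y s) := by
  refine ⟨by simp [hT, hX.1], ?_, fun t ht htD i j ↦ ?_⟩
  · refine ContinuousOn.if ?_ (hX.2.1.mono ?_) hY.continuousOn
    · rintro s ⟨-, hs⟩
      have hsT : s = T := frontier_le_subset_eq continuous_id continuous_const hs
      rw [hsT, hXY]
    · rintro s ⟨hs, hsT⟩
      exact ⟨hs.1, isClosed_Iic.closure_eq.le hsT⟩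
  · rw [Finset.mem_insert, not_or] at htD
    rcases lt_or_gt_of_ne htD.1 with htT | hTt
    · simp only [htT, htT.le, if_true]
      refine (hX.2.2 t ⟨ht.1, htT⟩ htD.2 i j).congr_of_eventuallyEq ?_
      filter_upwards [gt_mem_nhds htT] with s hs
      rw [if_pos hs.le]
    · simp only [hTt.not_ge, hTt.le.not_gt, if_false]
      refine (hY' t i j).congr_of_eventuallyEq ?_
      filter_upwards [lt_mem_nhds hTt] with s hs
      rw [if_neg hs.not_ge]

/-- The one-parameter subgroup of `SU(N)` generated by an element `C` of `su(N)`; it is the solution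
of `X' = C X`, `X 0 = 1`. -/
noncomputable def oneParam (hC : C ∈ su N) (t : ℝ) : specialUnitaryGroup (Fin N) ℂ :=
  ⟨exp (t • C), exp_mem_specialUnitaryGroup ((su N).smul_mem t hC)⟩

theorem oneParam_zero (hC : C ∈ su N) : oneParam hC 0 = 1 :=
  Subtype.ext ((congrArg exp (zero_smul ℝ C)).trans exp_zero)

theorem continuous_oneParam (hC : C ∈ su N) : Continuous (oneParam hC) :=
  (differentiable_exp_smul_const ℝ C).continuous.subtype_mk _

theorem hasDerivAt_oneParam_sub_mul_apply (hC : C ∈ su N) (g : specialUnitaryGroup (Fin N) ℂ)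
    (T t : ℝ) (i j : Fin N) :
    HasDerivAt (fun s ↦ (oneParam hC (s - T) * g : Matrix (Fin N) (Fin N) ℂ) i j)
      ((C * (oneParam hC (t - T) * g : Matrix (Fin N) (Fin N) ℂ)) i j) t := by
  have hderiv : HasDerivAt (fun s ↦ exp ((s - T) • C) * (g : Matrix (Fin N) (Fin N) ℂ))
      (C * (exp ((t - T) • C) * g)) t := by
    rw [← mul_assoc]
    exact ((hasDerivAt_exp_smul_const' (𝕂 := ℝ) C (t - T)).comp_sub_const t T).mul_const _
  exact (entryLinearMap ℝ ℂ i j).toContinuousLinearMap.hasFDerivAt.comp_hasDerivAt t hderiv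

theorem one_mem_reachableSet (A B : Matrix (Fin N) (Fin N) ℂ) : 1 ∈ reachableSet A B :=
  ⟨0, le_rfl, fun _ ↦ 0, ∅, fun _ ↦ 1, fun _ _ _ _ ↦ rfl,
    ⟨rfl, continuousOn_const, fun _ ht ↦ absurd (ht.1.trans ht.2) (lt_irrefl 0)⟩, rfl⟩

theorem oneParam_mul_mem_reachableSet {c : ℝ} (hC : A + c • B ∈ su N) {t : ℝ} (ht : 0 ≤ t)
    {g : specialUnitaryGroup (Fin N) ℂ} (hg : g ∈ reachableSet A B) :
    oneParam hC t * g ∈ reachableSet A B := by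
  obtain ⟨T, hT, u, D, X, hu, hX, rfl⟩ := hg
  let Y : ℝ → specialUnitaryGroup (Fin N) ℂ := fun s ↦ oneParam hC (s - T) * X T
  have hXY : X T = Y T := by simp only [Y, sub_self, oneParam_zero, one_mul]
  have hY : Continuous Y :=
    ((continuous_oneParam hC).comp (continuous_id.sub continuous_const)).mul continuous_const
  refine ⟨T + t, add_nonneg hT ht, _, _, _, hu.ite_lt T c,
    hX.ite_le hT hXY hY (hasDerivAt_oneParam_sub_mul_apply hC (X T) T) (T + t), ?_⟩
  rcases ht.eq_or_lt with rfl | ht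
  · simp only [add_zero, le_refl, if_true, oneParam_zero, one_mul]
  · simp only [add_le_iff_nonpos_right, ht.not_ge, if_false, Y, add_sub_cancel_left]

theorem flowMonoid_subset_reachableSet (hA : A ∈ su N) (hB : B ∈ su N) :
    (flowMonoid (specialUnitaryGroup (Fin N) ℂ).subtype (Set.range fun c : ℝ ↦ A + c • B) :
      Set (specialUnitaryGroup (Fin N) ℂ)) ⊆ reachableSet A B := by
  intro g hg
  induction hg using Submonoid.closure_induction_left with
  | one => exact one_mem_reachableSet A B
  | mul_left g hg h _ hh =>
    obtain ⟨_, ⟨c, rfl⟩, t, ht, hg⟩ := hg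
    have hC : A + c • B ∈ su N := (su N).add_mem hA ((su N).smul_mem c hB)
    have hgt : g = oneParam hC t := Subtype.ext hg
    exact hgt ▸ oneParam_mul_mem_reachableSet hC ht hh

theorem isControllable_of_su_le_lieSpan (hA : A ∈ su N) (hB : B ∈ su N)
    (hspan : su N ≤ (LieSubalgebra.lieSpan ℝ (Matrix (Fin N) (Fin N) ℂ)
      (Set.range fun c : ℝ ↦ A + c • B)).toSubmodule) : IsControllable A B := by
  have hinputs : (Set.range fun c : ℝ ↦ A + c • B) ⊆ su N :=
    Set.range_subset_iff.2 fun c ↦ (su N).add_mem hA ((su N).smul_mem c hB)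
  have htop := flowMonoid_eq_top (ι := (specialUnitaryGroup (Fin N) ℂ).subtype)
    continuous_subtype_val Subtype.val_injective (isLieAlgebraOf_su N) hinputs hspan
  refine Set.eq_univ_of_forall fun g ↦ flowMonoid_subset_reachableSet hA hB ?_
  rw [SetLike.mem_coe, htop]
  exact Submonoid.mem_top g

end Control

end QuantumControl

theorem mainTheorem1 (N : ℕ) (A B : Matrix (Fin N) (Fin N) ℂ)
    (hA : A ∈ QuantumControl.su N) (hB : B ∈ QuantumControl.su N)
    (hdiag : A.IsDiag) (hord : Monotone (QuantumControl.energy A))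
    (hconn : (QuantumControl.matrixGraph B).toSimpleGraphInclusive.Connected)
    (hreg : QuantumControl.IsRegularAlong A B) :
    QuantumControl.IsControllable A B :=
  QuantumControl.isControllable_of_su_le_lieSpan hA hB
    (QuantumControl.su_le_lieSpan hA hB hdiag hord hconn hreg)
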